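/- Let $A$ be a unital $C^*$-algebra with unit $1$. Equip the algebraic tensor product $A\otimes A$ (over $\mathbb{C}$, with multiplication $(a\otimes b)(c\otimes d)=ac\otimes bd$) with the operator space projective tensor norm $$\|u\|_{\wedge}=\inf\{\|\alpha\|\,\|v\|\,\|w\|\,\|\beta\| : u=\alpha(v\otimes w)\beta\},$$ where the infimum is over $p,q\in\mathbb{N}$, $\alpha\in M_{1,pq}(\mathbb{C})$, $\beta\in M_{pq,1}(\mathbb{C})$, $v\in M_p(A)$, $w\in M_q(A)$ (with their $C^*$-norms), and $v\otimes w=(v_{ij}\otimes w_{kl})_{(i,k),(j,l)}\in M_{pq}(A\otimes A)$. Let $A\widehat\otimes_r A$ be the Banach $*$-algebra obtained as the completion of $(A\otimes A,\|\cdot\|_\wedge)$, with the reverse involution, i.e. the isometric conjugate-linear involution determined by $(a\otimes b)^*=b^*\otimes a^*$. Then $A\widehat\otimes_r A$ has a faithful $*$-representation (an injective $*$-homomorphism into the bounded operators $\mathcal{B}(H)$ of some complex Hilbert space $H$) if and only if $A=\mathbb{C}1$, that is, every element of $A$ is a scalar multiple of $1$. -/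

import Mathlib

universe u v

open scoped TensorProduct Matrix

noncomputable section

namespace OpProj

section MatNorm

/-- The `C*`-norm on square matrices over a `C*`-algebra `A`, that is, the norm of the `n`-th
matrix level of the canonical operator space structure of `A`. -/
def matNorm {A : Type*} [CStarAlgebra A] {n : Type*} [Fintype n] (v : Matrix n n A) : ℝ :=
  letI := CStarAlgebra.spectralOrder A
  haveI := CStarAlgebra.spectralOrderedRing A
  ‖CStarMatrix.ofMatrix v‖

variable {A : Type*} [CStarAlgebra A] {m n : Type*} [Fintype m] [Fintype n]

theorem matNorm_nonneg (v : Matrix n n A) : 0 ≤ matNorm v := by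
  let _ := CStarAlgebra.spectralOrder A
  have := CStarAlgebra.spectralOrderedRing A
  exact norm_nonneg (CStarMatrix.ofMatrix v)

theorem matNorm_smul (c : ℂ) (v : Matrix n n A) : matNorm (c • v) = ‖c‖ * matNorm v := by
  let _ := CStarAlgebra.spectralOrder A
  have := CStarAlgebra.spectralOrderedRing A
  exact norm_smul c (CStarMatrix.ofMatrix v)

theorem matNorm_mul_le (v w : Matrix n n A) : matNorm (v * w) ≤ matNorm v * matNorm w := by
  let _ := CStarAlgebra.spectralOrder A
  have := CStarAlgebra.spectralOrderedRing A
  exact norm_mul_le (CStarMatrix.ofMatrix v) (CStarMatrix.ofMatrix w)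

theorem matNorm_conjTranspose (v : Matrix n n A) : matNorm vᴴ = matNorm v := by
  let _ := CStarAlgebra.spectralOrder A
  have := CStarAlgebra.spectralOrderedRing A
  exact norm_star (CStarMatrix.ofMatrix v)

theorem eq_zero_of_matNorm (v : Matrix n n A) (h : matNorm v = 0) : v = 0 := by
  let _ := CStarAlgebra.spectralOrder A
  have := CStarAlgebra.spectralOrderedRing A
  exact norm_eq_zero.1 (show ‖CStarMatrix.ofMatrix v‖ = 0 from h)

theorem matNorm_hom_le [DecidableEq m] [DecidableEq n] (f : Matrix m m A → Matrix n n A)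
    (hs : ∀ (c : ℂ) v, f (c • v) = c • f v) (hz : f 0 = 0)
    (ha : ∀ v w, f (v + w) = f v + f w) (hm : ∀ v w, f (v * w) = f v * f w)
    (ht : ∀ v, f vᴴ = (f v)ᴴ) (v : Matrix m m A) : matNorm (f v) ≤ matNorm v := by
  let _ := CStarAlgebra.spectralOrder A
  have := CStarAlgebra.spectralOrderedRing A
  let φ : CStarMatrix m m A →⋆ₙₐ[ℂ] CStarMatrix n n A :=
    { toFun := f, map_smul' := hs, map_zero' := hz, map_add' := ha, map_mul' := hm,
      map_star' := ht }
  exact NonUnitalStarAlgHom.norm_apply_le φ (CStarMatrix.ofMatrix v)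

theorem matNorm_fromBlocks_le [DecidableEq m] [DecidableEq n] (v : Matrix m m A)
    (w : Matrix n n A) : matNorm (Matrix.fromBlocks v 0 0 w) ≤ max (matNorm v) (matNorm w) := by
  let _ := CStarAlgebra.spectralOrder A
  have := CStarAlgebra.spectralOrderedRing A
  let φ : CStarMatrix m m A × CStarMatrix n n A →⋆ₙₐ[ℂ] CStarMatrix (m ⊕ n) (m ⊕ n) A :=
    { toFun := fun p => CStarMatrix.ofMatrix (Matrix.fromBlocks p.1 0 0 p.2)
      map_smul' := fun c p => by
        have := Matrix.fromBlocks_smul c (p.1 : Matrix m m A) 0 0 (p.2 : Matrix n n A)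
        simp only [smul_zero] at this
        exact this.symm
      map_zero' := Matrix.fromBlocks_zero
      map_add' := fun p q => by
        have := Matrix.fromBlocks_add (p.1 : Matrix m m A) 0 0 (p.2 : Matrix n n A) q.1 0 0 q.2
        simp only [add_zero] at this
        exact this.symm
      map_mul' := fun p q => by
        have key : ∀ (a c : Matrix m m A) (b d : Matrix n n A),
            Matrix.fromBlocks (a * c) 0 0 (b * d)
              = Matrix.fromBlocks a 0 0 b * Matrix.fromBlocks c 0 0 d := by
          intro a c b d
          simp [Matrix.fromBlocks_multiply]
        exact key p.1 q.1 p.2 q.2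
      map_star' := fun p => by
        have := Matrix.fromBlocks_conjTranspose (p.1 : Matrix m m A) 0 0 (p.2 : Matrix n n A)
        simp only [Matrix.conjTranspose_zero] at this
        exact this.symm }
  exact NonUnitalStarAlgHom.norm_apply_le φ (CStarMatrix.ofMatrix v, CStarMatrix.ofMatrix w)

theorem matNorm_reindex_le [DecidableEq m] [DecidableEq n] (e : m ≃ n) (v : Matrix m m A) :
    matNorm (Matrix.reindex e e v) ≤ matNorm v :=
  matNorm_hom_le (fun v => Matrix.reindex e e v) (fun _ _ => rfl) rfl (fun _ _ => rfl)
    (fun v w => by simp [Matrix.submatrix_mul_equiv]) (fun _ => rfl) v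

theorem matNorm_kronecker_le [DecidableEq m] [DecidableEq n] (v : Matrix m m A)
    (w : Matrix n n A) :
    matNorm (Matrix.of fun x y : m × n => v x.1 y.1 * w x.2 y.2) ≤ matNorm v * matNorm w := by
  have hv : matNorm (Matrix.of fun x y : m × n => if x.2 = y.2 then v x.1 y.1 else 0)
      ≤ matNorm v := by
    refine matNorm_hom_le
      (fun v => Matrix.of fun x y : m × n => if x.2 = y.2 then v x.1 y.1 else 0)
      ?_ ?_ ?_ ?_ ?_ v
    · intro c v; ext x y; simp
    · ext x y; simp
    · intro v w; ext x y; by_cases h : x.2 = y.2 <;> simp [h]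
    · intro v w; ext x y
      simp [Matrix.mul_apply, Fintype.sum_prod_type]
    · intro v; ext x y
      by_cases h : x.2 = y.2
      · simp [h]
      · simp [h, Ne.symm h]
  have hw : matNorm (Matrix.of fun x y : m × n => if x.1 = y.1 then w x.2 y.2 else 0)
      ≤ matNorm w := by
    refine matNorm_hom_le
      (fun w => Matrix.of fun x y : m × n => if x.1 = y.1 then w x.2 y.2 else 0)
      ?_ ?_ ?_ ?_ ?_ w
    · intro c v; ext x y; simp
    · ext x y; simp
    · intro v w; ext x y; by_cases h : x.1 = y.1 <;> simp [h]
    · intro v w; ext x y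
      simp only [Matrix.mul_apply, Matrix.of_apply, Fintype.sum_prod_type]
      rw [Finset.sum_comm]
      simp
    · intro v; ext x y
      by_cases h : x.1 = y.1
      · simp [h]
      · simp [h, Ne.symm h]
  have hmul : (Matrix.of fun x y : m × n => v x.1 y.1 * w x.2 y.2)
      = (Matrix.of fun x y : m × n => if x.2 = y.2 then v x.1 y.1 else 0)
        * (Matrix.of fun x y : m × n => if x.1 = y.1 then w x.2 y.2 else 0) := by
    ext x y
    simp [Matrix.mul_apply, Fintype.sum_prod_type]
  rw [hmul]
  exact (matNorm_mul_le _ _).trans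
    (mul_le_mul hv hw (matNorm_nonneg _) (matNorm_nonneg _))

end MatNorm

section Norm

variable {A B : Type*} [CStarAlgebra A] [CStarAlgebra B]

/-- The element `α (v ⊗ w) β` of `A ⊗ B`, where `α` is a row, `β` is a column, and
`v ⊗ w = (v i j ⊗ w k l)_{(i,k),(j,l)}`. -/
def sandwich {ι κ : Type*} [Fintype ι] [Fintype κ] (α : EuclideanSpace ℂ (ι × κ))
    (v : Matrix ι ι A) (w : Matrix κ κ B) (β : EuclideanSpace ℂ (ι × κ)) : A ⊗[ℂ] B :=
  ∑ x : ι × κ, ∑ y : ι × κ, (α x * β y) • (v x.1 y.1 ⊗ₜ[ℂ] w x.2 y.2)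

/-- The operator space projective tensor norm on the algebraic tensor product `A ⊗ B`:
`‖u‖ = inf { ‖α‖ ‖v‖ ‖w‖ ‖β‖ : u = α (v ⊗ w) β }`. The operator norm of the scalar row `α`
(column `β`) is its Euclidean norm. -/
def projNorm (u : A ⊗[ℂ] B) : ℝ :=
  sInf {r : ℝ | ∃ (p q : ℕ) (α : EuclideanSpace ℂ (Fin p × Fin q))
    (v : Matrix (Fin p) (Fin p) A) (w : Matrix (Fin q) (Fin q) B)
    (β : EuclideanSpace ℂ (Fin p × Fin q)),
    u = sandwich α v w β ∧ r = ‖α‖ * matNorm v * matNorm w * ‖β‖}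

theorem projNorm_bddBelow (u : A ⊗[ℂ] B) :
    BddBelow {r : ℝ | ∃ (p q : ℕ) (α : EuclideanSpace ℂ (Fin p × Fin q))
    (v : Matrix (Fin p) (Fin p) A) (w : Matrix (Fin q) (Fin q) B)
    (β : EuclideanSpace ℂ (Fin p × Fin q)),
    u = sandwich α v w β ∧ r = ‖α‖ * matNorm v * matNorm w * ‖β‖} := by
  refine ⟨0, ?_⟩
  rintro r ⟨p, q, α, v, w, β, -, rfl⟩
  have := matNorm_nonneg v
  have := matNorm_nonneg w
  positivity

theorem projNorm_nonneg (u : A ⊗[ℂ] B) : 0 ≤ projNorm u := by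
  refine Real.sInf_nonneg ?_
  rintro r ⟨p, q, α, v, w, β, -, rfl⟩
  have := matNorm_nonneg v
  have := matNorm_nonneg w
  positivity

theorem sandwich_reindex {ι κ ι' κ' : Type*} [Fintype ι] [Fintype κ] [Fintype ι'] [Fintype κ']
    (e : ι ≃ ι') (f : κ ≃ κ') (α : EuclideanSpace ℂ (ι × κ))
    (v : Matrix ι ι A) (w : Matrix κ κ B) (β : EuclideanSpace ℂ (ι × κ)) :
    sandwich (LinearIsometryEquiv.piLpCongrLeft 2 ℂ ℂ (e.prodCongr f) α)
      (Matrix.reindex e e v) (Matrix.reindex f f w)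
      (LinearIsometryEquiv.piLpCongrLeft 2 ℂ ℂ (e.prodCongr f) β) = sandwich α v w β := by
  unfold sandwich
  refine (Fintype.sum_equiv (e.prodCongr f) _ _ fun x => ?_).symm
  refine (Fintype.sum_equiv (e.prodCongr f) _ _ fun y => ?_)
  obtain ⟨x₁, x₂⟩ := x
  obtain ⟨y₁, y₂⟩ := y
  simp [LinearIsometryEquiv.piLpCongrLeft_apply, Equiv.piCongrLeft']

theorem exists_fin_sandwich {ι κ : Type*} [Fintype ι] [Fintype κ]
    (α : EuclideanSpace ℂ (ι × κ))
    (v : Matrix ι ι A) (w : Matrix κ κ B) (β : EuclideanSpace ℂ (ι × κ)) :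
    ∃ (p q : ℕ) (α' : EuclideanSpace ℂ (Fin p × Fin q))
    (v' : Matrix (Fin p) (Fin p) A) (w' : Matrix (Fin q) (Fin q) B)
    (β' : EuclideanSpace ℂ (Fin p × Fin q)),
    sandwich α v w β = sandwich α' v' w' β' ∧
      ‖α'‖ * matNorm v' * matNorm w' * ‖β'‖ ≤ ‖α‖ * matNorm v * matNorm w * ‖β‖ := by
  classical
  refine ⟨_, _, _, _, _, _,
    (sandwich_reindex (Fintype.equivFin ι) (Fintype.equivFin κ) α v w β).symm, ?_⟩
  simp only [LinearIsometryEquiv.norm_map]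
  have h1 := matNorm_reindex_le (Fintype.equivFin ι) v
  have h2 := matNorm_reindex_le (Fintype.equivFin κ) w
  have h3 := matNorm_nonneg (Matrix.reindex (Fintype.equivFin κ) (Fintype.equivFin κ) w)
  have h4 := matNorm_nonneg v
  gcongr

theorem projNorm_sandwich_le {ι κ : Type*} [Fintype ι] [Fintype κ]
    (α : EuclideanSpace ℂ (ι × κ))
    (v : Matrix ι ι A) (w : Matrix κ κ B) (β : EuclideanSpace ℂ (ι × κ)) :
    projNorm (sandwich α v w β) ≤ ‖α‖ * matNorm v * matNorm w * ‖β‖ := by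
  obtain ⟨p, q, α', v', w', β', h, hle⟩ := exists_fin_sandwich α v w β
  exact (csInf_le (projNorm_bddBelow _) ⟨p, q, α', v', w', β', h, rfl⟩).trans hle

theorem sandwich_smul {ι κ : Type*} [Fintype ι] [Fintype κ] (a b c d : ℂ)
    (α : EuclideanSpace ℂ (ι × κ))
    (v : Matrix ι ι A) (w : Matrix κ κ B) (β : EuclideanSpace ℂ (ι × κ)) :
    sandwich (a • α) (b • v) (c • w) (d • β) = (a * b * c * d) • sandwich α v w β := by
  unfold sandwich
  simp only [Finset.smul_sum]
  refine Finset.sum_congr rfl fun x _ => Finset.sum_congr rfl fun y _ => ?_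
  simp only [PiLp.smul_apply, smul_eq_mul, Matrix.smul_apply, TensorProduct.tmul_smul,
    TensorProduct.smul_tmul', smul_smul]
  congr 1
  ring_nf

/-- The row (or column) over the block index set that is made of two rows on the two diagonal
blocks and vanishes elsewhere. -/
def blockVec {ι κ ι' κ' : Type*} [Fintype ι] [Fintype κ] [Fintype ι'] [Fintype κ']
    (α : EuclideanSpace ℂ (ι × κ)) (α' : EuclideanSpace ℂ (ι' × κ')) :
    EuclideanSpace ℂ ((ι ⊕ ι') × (κ ⊕ κ')) :=
  WithLp.toLp 2 fun x => match x with
    | (Sum.inl i, Sum.inl k) => α (i, k)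
    | (Sum.inr i, Sum.inr k) => α' (i, k)
    | _ => 0

theorem norm_blockVec_sq {ι κ ι' κ' : Type*} [Fintype ι] [Fintype κ] [Fintype ι'] [Fintype κ']
    (α : EuclideanSpace ℂ (ι × κ)) (α' : EuclideanSpace ℂ (ι' × κ')) :
    ‖blockVec α α'‖ ^ 2 = ‖α‖ ^ 2 + ‖α'‖ ^ 2 := by
  simp [EuclideanSpace.norm_sq_eq, blockVec, Fintype.sum_prod_type]

theorem sandwich_block {ι κ ι' κ' : Type*} [Fintype ι] [Fintype κ] [Fintype ι'] [Fintype κ']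
    (α β : EuclideanSpace ℂ (ι × κ)) (α' β' : EuclideanSpace ℂ (ι' × κ'))
    (v : Matrix ι ι A) (w : Matrix κ κ B) (v' : Matrix ι' ι' A) (w' : Matrix κ' κ' B) :
    sandwich (blockVec α α') (Matrix.fromBlocks v 0 0 v') (Matrix.fromBlocks w 0 0 w')
      (blockVec β β') = sandwich α v w β + sandwich α' v' w' β' := by
  simp [sandwich, blockVec, Fintype.sum_prod_type]

theorem exists_sandwich (u : A ⊗[ℂ] B) : ∃ (p q : ℕ) (α : EuclideanSpace ℂ (Fin p × Fin q))
    (v : Matrix (Fin p) (Fin p) A) (w : Matrix (Fin q) (Fin q) B)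
    (β : EuclideanSpace ℂ (Fin p × Fin q)), u = sandwich α v w β := by
  induction u using TensorProduct.induction_on with
  | zero => exact ⟨0, 0, 0, 0, 0, 0, by simp [sandwich]⟩
  | tmul a b =>
    refine ⟨1, 1, WithLp.toLp 2 fun _ => 1, fun _ _ => a, fun _ _ => b,
      WithLp.toLp 2 fun _ => 1, ?_⟩
    simp [sandwich]
  | add u₁ u₂ h₁ h₂ =>
    obtain ⟨p, q, α, v, w, β, rfl⟩ := h₁
    obtain ⟨p', q', α', v', w', β', rfl⟩ := h₂
    obtain ⟨P, Q, a, b, c, d, h, -⟩ := exists_fin_sandwich (blockVec α α')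
      (Matrix.fromBlocks v 0 0 v') (Matrix.fromBlocks w 0 0 w') (blockVec β β')
    exact ⟨P, Q, a, b, c, d, by rw [← h, sandwich_block]⟩

theorem projNorm_zero : projNorm (0 : A ⊗[ℂ] B) = 0 := by
  refine le_antisymm ?_ (projNorm_nonneg _)
  have := projNorm_sandwich_le (A := A) (B := B) (ι := Fin 0) (κ := Fin 0) 0 0 0 0
  simpa [sandwich] using this

theorem exists_sandwich_lt {u : A ⊗[ℂ] B} {c : ℝ} (h : projNorm u < c) :
    ∃ (p q : ℕ) (α : EuclideanSpace ℂ (Fin p × Fin q))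
    (v : Matrix (Fin p) (Fin p) A) (w : Matrix (Fin q) (Fin q) B)
    (β : EuclideanSpace ℂ (Fin p × Fin q)), u = sandwich α v w β ∧
      ‖α‖ * matNorm v * matNorm w * ‖β‖ < c := by
  have hne : {r : ℝ | ∃ (p q : ℕ) (α : EuclideanSpace ℂ (Fin p × Fin q))
    (v : Matrix (Fin p) (Fin p) A) (w : Matrix (Fin q) (Fin q) B)
    (β : EuclideanSpace ℂ (Fin p × Fin q)),
    u = sandwich α v w β ∧ r = ‖α‖ * matNorm v * matNorm w * ‖β‖}.Nonempty := by
    obtain ⟨p, q, α, v, w, β, h⟩ := exists_sandwich u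
    exact ⟨_, p, q, α, v, w, β, h, rfl⟩
  obtain ⟨r, ⟨p, q, α, v, w, β, hu, rfl⟩, hr⟩ := exists_lt_of_csInf_lt hne h
  exact ⟨p, q, α, v, w, β, hu, hr⟩

theorem exists_sandwich_normalized {u : A ⊗[ℂ] B} {c : ℝ} (h : projNorm u < c) :
    ∃ (p q : ℕ) (α : EuclideanSpace ℂ (Fin p × Fin q))
    (v : Matrix (Fin p) (Fin p) A) (w : Matrix (Fin q) (Fin q) B)
    (β : EuclideanSpace ℂ (Fin p × Fin q)), u = sandwich α v w β ∧
      matNorm v ≤ 1 ∧ matNorm w ≤ 1 ∧ ‖α‖ ^ 2 ≤ c ∧ ‖β‖ ^ 2 ≤ c := by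
  have hc : 0 < c := (projNorm_nonneg u).trans_lt h
  obtain ⟨p, q, α, v, w, β, hu, hlt⟩ := exists_sandwich_lt h
  have hv := matNorm_nonneg v
  have hw := matNorm_nonneg w
  set P := ‖α‖ * matNorm v * matNorm w * ‖β‖ with hP
  by_cases hP0 : P = 0
  · have hu0 : u = 0 := by
      rw [hP] at hP0
      simp only [mul_eq_zero, norm_eq_zero] at hP0
      rw [hu]
      rcases hP0 with ((h0 | h0) | h0) | h0
      · simp [sandwich, h0]
      · simp [sandwich, eq_zero_of_matNorm v h0]
      · simp [sandwich, eq_zero_of_matNorm w h0]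
      · simp [sandwich, h0]
    refine ⟨0, 0, 0, 0, 0, 0, by simp [sandwich, hu0], ?_, ?_, by simpa using hc.le,
      by simpa using hc.le⟩
    · have := matNorm_smul (A := A) (n := Fin 0) 0 0
      simp at this
      simp [this]
    · have := matNorm_smul (A := B) (n := Fin 0) 0 0
      simp at this
      simp [this]
  · have hPpos : 0 < P := lt_of_le_of_ne (by positivity) (Ne.symm hP0)
    have hα : 0 < ‖α‖ := (norm_nonneg α).lt_of_ne fun h0 => hP0 (by rw [hP, ← h0]; ring)
    have hβ : 0 < ‖β‖ := (norm_nonneg β).lt_of_ne fun h0 => hP0 (by rw [hP, ← h0]; ring)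
    have hv' : 0 < matNorm v := hv.lt_of_ne fun h0 => hP0 (by rw [hP, ← h0]; ring)
    have hw' : 0 < matNorm w := hw.lt_of_ne fun h0 => hP0 (by rw [hP, ← h0]; ring)
    refine ⟨p, q, ((√P / ‖α‖ : ℝ) : ℂ) • α, (((matNorm v)⁻¹ : ℝ) : ℂ) • v,
      (((matNorm w)⁻¹ : ℝ) : ℂ) • w, ((√P / ‖β‖ : ℝ) : ℂ) • β, ?_, ?_, ?_, ?_, ?_⟩
    · rw [sandwich_smul, ← hu]
      have : (√P / ‖α‖) * (matNorm v)⁻¹ * (matNorm w)⁻¹ * (√P / ‖β‖) = 1 := by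
        have hs : √P * √P = P := Real.mul_self_sqrt hPpos.le
        field_simp
        rw [sq, hs, hP]
      rw [← Complex.ofReal_mul, ← Complex.ofReal_mul, ← Complex.ofReal_mul, this,
        Complex.ofReal_one, one_smul]
    · rw [matNorm_smul, Complex.norm_real, norm_inv, Real.norm_of_nonneg hv,
        inv_mul_cancel₀ hv'.ne']
    · rw [matNorm_smul, Complex.norm_real, norm_inv, Real.norm_of_nonneg hw,
        inv_mul_cancel₀ hw'.ne']
    · rw [norm_smul, Complex.norm_real, Real.norm_of_nonneg (by positivity),
        div_mul_cancel₀ _ hα.ne', Real.sq_sqrt hPpos.le]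
      exact hlt.le
    · rw [norm_smul, Complex.norm_real, Real.norm_of_nonneg (by positivity),
        div_mul_cancel₀ _ hβ.ne', Real.sq_sqrt hPpos.le]
      exact hlt.le

theorem projNorm_add_le (u₁ u₂ : A ⊗[ℂ] B) :
    projNorm (u₁ + u₂) ≤ projNorm u₁ + projNorm u₂ := by
  refine le_of_forall_pos_le_add fun ε hε => ?_
  obtain ⟨p, q, α, v, w, β, hu, hv, hw, hα, hβ⟩ :=
    exists_sandwich_normalized (lt_add_of_pos_right (projNorm u₁) (half_pos hε))
  obtain ⟨p', q', α', v', w', β', hu', hv', hw', hα', hβ'⟩ :=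
    exists_sandwich_normalized (lt_add_of_pos_right (projNorm u₂) (half_pos hε))
  rw [hu, hu', ← sandwich_block, ← hu, ← hu']
  refine (projNorm_sandwich_le _ _ _ _).trans ?_
  have h1 := norm_blockVec_sq α α'
  have h2 := norm_blockVec_sq β β'
  have h3 := (matNorm_fromBlocks_le v v').trans (max_le hv hv')
  have h4 := (matNorm_fromBlocks_le w w').trans (max_le hw hw')
  have h5 := matNorm_nonneg (Matrix.fromBlocks v 0 0 v')
  have h6 := matNorm_nonneg (Matrix.fromBlocks w 0 0 w')
  calc ‖blockVec α α'‖ * matNorm (Matrix.fromBlocks v 0 0 v')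
        * matNorm (Matrix.fromBlocks w 0 0 w') * ‖blockVec β β'‖
      ≤ ‖blockVec α α'‖ * 1 * 1 * ‖blockVec β β'‖ := by gcongr
    _ ≤ projNorm u₁ + projNorm u₂ + ε := by
      nlinarith [sq_nonneg (‖blockVec α α'‖ - ‖blockVec β β'‖)]

theorem projNorm_smul_le (c : ℂ) (u : A ⊗[ℂ] B) : projNorm (c • u) ≤ ‖c‖ * projNorm u := by
  refine le_of_forall_pos_le_add fun ε hε => ?_
  have hpos : 0 < ‖c‖ + 1 := by positivity
  obtain ⟨p, q, α, v, w, β, hu, hlt⟩ :=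
    exists_sandwich_lt (lt_add_of_pos_right (projNorm u) (div_pos hε hpos))
  have h := sandwich_smul c 1 1 1 α v w β
  simp only [mul_one, one_smul, ← hu] at h
  rw [← h]
  refine (projNorm_sandwich_le _ _ _ _).trans ?_
  rw [norm_smul]
  calc ‖c‖ * ‖α‖ * matNorm v * matNorm w * ‖β‖
      = ‖c‖ * (‖α‖ * matNorm v * matNorm w * ‖β‖) := by ring
    _ ≤ ‖c‖ * (projNorm u + ε / (‖c‖ + 1)) := by gcongr
    _ = ‖c‖ * projNorm u + ε * (‖c‖ / (‖c‖ + 1)) := by ring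
    _ ≤ ‖c‖ * projNorm u + ε * 1 := by
      gcongr
      exact (div_le_one hpos).2 (by linarith)
    _ = _ := by ring

theorem projNorm_smul (c : ℂ) (u : A ⊗[ℂ] B) : projNorm (c • u) = ‖c‖ * projNorm u := by
  refine le_antisymm (projNorm_smul_le c u) ?_
  by_cases hc : c = 0
  · simp [hc, projNorm_nonneg]
  · have h := projNorm_smul_le c⁻¹ (c • u)
    rw [inv_smul_smul₀ hc, norm_inv] at h
    have hc' : 0 < ‖c‖ := norm_pos_iff.2 hc
    rwa [inv_mul_eq_div, le_div_iff₀' hc'] at h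

theorem sandwich_mul {ι κ ι' κ' : Type*} [Fintype ι] [Fintype κ] [Fintype ι'] [Fintype κ']
    (α β : EuclideanSpace ℂ (ι × κ)) (α' β' : EuclideanSpace ℂ (ι' × κ'))
    (v : Matrix ι ι A) (w : Matrix κ κ B) (v' : Matrix ι' ι' A) (w' : Matrix κ' κ' B) :
    sandwich α v w β * sandwich α' v' w' β' =
      sandwich (WithLp.toLp 2 fun x : (ι × ι') × (κ × κ') =>
          α (x.1.1, x.2.1) * α' (x.1.2, x.2.2))
        (Matrix.of fun x y : ι × ι' => v x.1 y.1 * v' x.2 y.2)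
        (Matrix.of fun x y : κ × κ' => w x.1 y.1 * w' x.2 y.2)
        (WithLp.toLp 2 fun x : (ι × ι') × (κ × κ') =>
          β (x.1.1, x.2.1) * β' (x.1.2, x.2.2)) := by
  unfold sandwich
  rw [Fintype.sum_mul_sum, ← Fintype.sum_prod_type']
  refine Fintype.sum_equiv (Equiv.prodProdProdComm ι κ ι' κ') _ _ fun x => ?_
  rw [Fintype.sum_mul_sum, ← Fintype.sum_prod_type']
  refine Fintype.sum_equiv (Equiv.prodProdProdComm ι κ ι' κ') _ _ fun y => ?_
  simp only [Equiv.prodProdProdComm_apply, Matrix.of_apply, smul_mul_smul_comm,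
    Algebra.TensorProduct.tmul_mul_tmul]
  congr 1
  ring

theorem norm_prodVec {ι κ ι' κ' : Type*} [Fintype ι] [Fintype κ] [Fintype ι'] [Fintype κ']
    (α : EuclideanSpace ℂ (ι × κ)) (α' : EuclideanSpace ℂ (ι' × κ')) :
    ‖(WithLp.toLp 2 fun x : (ι × ι') × (κ × κ') => α (x.1.1, x.2.1) * α' (x.1.2, x.2.2) :
      EuclideanSpace ℂ ((ι × ι') × (κ × κ')))‖ = ‖α‖ * ‖α'‖ := by
  rw [← sq_eq_sq₀ (norm_nonneg _) (by positivity), mul_pow]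
  simp only [EuclideanSpace.norm_sq_eq]
  rw [Fintype.sum_mul_sum, ← Fintype.sum_prod_type']
  refine (Fintype.sum_equiv (Equiv.prodProdProdComm ι κ ι' κ') _ _ fun x => ?_).symm
  simp [mul_pow]

theorem projNorm_mul_le (u₁ u₂ : A ⊗[ℂ] B) :
    projNorm (u₁ * u₂) ≤ projNorm u₁ * projNorm u₂ := by
  have key : ∀ c₁ > projNorm u₁, ∀ c₂ > projNorm u₂, projNorm (u₁ * u₂) ≤ c₁ * c₂ := by
    intro c₁ h₁ c₂ h₂
    obtain ⟨p, q, α, v, w, β, hu, hlt⟩ := exists_sandwich_lt h₁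
    obtain ⟨p', q', α', v', w', β', hu', hlt'⟩ := exists_sandwich_lt h₂
    rw [hu, hu', sandwich_mul]
    refine (projNorm_sandwich_le _ _ _ _).trans ?_
    rw [norm_prodVec, norm_prodVec]
    have h3 := matNorm_kronecker_le v v'
    have h4 := matNorm_kronecker_le w w'
    have h5 := matNorm_nonneg v
    have h6 := matNorm_nonneg v'
    have h7 := matNorm_nonneg w
    have h8 := matNorm_nonneg w'
    have h9 := matNorm_nonneg (Matrix.of fun x y : Fin q × Fin q' => w x.1 y.1 * w' x.2 y.2)
    calc _ ≤ ‖α‖ * ‖α'‖ * (matNorm v * matNorm v') * (matNorm w * matNorm w')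
          * (‖β‖ * ‖β'‖) := by gcongr
      _ = (‖α‖ * matNorm v * matNorm w * ‖β‖) * (‖α'‖ * matNorm v' * matNorm w' * ‖β'‖) := by
        ring
      _ ≤ c₁ * c₂ := by
        have := projNorm_nonneg u₁
        gcongr
        linarith
  have hlim : Filter.Tendsto (fun ε : ℝ => (projNorm u₁ + ε) * (projNorm u₂ + ε))
      (nhdsWithin 0 (Set.Ioi 0)) (nhds (projNorm u₁ * projNorm u₂)) := by
    have : Continuous fun ε : ℝ => (projNorm u₁ + ε) * (projNorm u₂ + ε) := by fun_prop
    have h := (this.tendsto 0).mono_left (nhdsWithin_le_nhds (s := Set.Ioi 0))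
    simpa using h
  refine ge_of_tendsto hlim ?_
  filter_upwards [self_mem_nhdsWithin] with ε hε
  have hε' : (0 : ℝ) < ε := hε
  exact key _ (by linarith) _ (by linarith)

end Norm

section Reverse

variable {A : Type*} [CStarAlgebra A]

/-- The reverse involution on the algebraic tensor product `A ⊗ A`: the conjugate linear map
with `(a ⊗ b)* = b* ⊗ a*`. -/
def revStar (u : A ⊗[ℂ] A) : A ⊗[ℂ] A := TensorProduct.comm ℂ A A (star u)

@[simp]
theorem revStar_tmul (a b : A) : revStar (a ⊗ₜ[ℂ] b) = star b ⊗ₜ[ℂ] star a := rfl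

theorem revStar_add (u v : A ⊗[ℂ] A) : revStar (u + v) = revStar u + revStar v := by
  simp [revStar]

theorem revStar_smul (c : ℂ) (u : A ⊗[ℂ] A) : revStar (c • u) = star c • revStar u := by
  simp [revStar]

theorem revStar_zero : revStar (0 : A ⊗[ℂ] A) = 0 := by
  simp [revStar]

theorem revStar_revStar (u : A ⊗[ℂ] A) : revStar (revStar u) = u := by
  induction u using TensorProduct.induction_on with
  | zero => simp [revStar_zero]
  | tmul a b => simp
  | add u v hu hv => rw [revStar_add, revStar_add, hu, hv]

theorem revStar_mul (u v : A ⊗[ℂ] A) : revStar (u * v) = revStar v * revStar u := by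
  induction u using TensorProduct.induction_on with
  | zero => simp [revStar_zero]
  | add u u' hu hu' => rw [add_mul, revStar_add, hu, hu', revStar_add, mul_add]
  | tmul a b =>
    induction v using TensorProduct.induction_on with
    | zero => simp [revStar_zero]
    | add v v' hv hv' => rw [mul_add, revStar_add, hv, hv', revStar_add, add_mul]
    | tmul c d => simp [Algebra.TensorProduct.tmul_mul_tmul]

theorem revStar_sum {ι : Type*} (s : Finset ι) (f : ι → A ⊗[ℂ] A) :
    revStar (∑ i ∈ s, f i) = ∑ i ∈ s, revStar (f i) := by
  simp [revStar, star_sum]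

theorem revStar_sandwich {ι κ : Type*} [Fintype ι] [Fintype κ]
    (α β : EuclideanSpace ℂ (ι × κ)) (v : Matrix ι ι A) (w : Matrix κ κ A) :
    revStar (sandwich α v w β) =
      sandwich (WithLp.toLp 2 fun x : κ × ι => star (β x.swap)) wᴴ vᴴ
        (WithLp.toLp 2 fun x : κ × ι => star (α x.swap)) := by
  unfold sandwich
  simp only [revStar_sum, revStar_smul, revStar_tmul]
  rw [Finset.sum_comm]
  refine Fintype.sum_equiv (Equiv.prodComm ι κ) _ _ fun x => ?_
  refine Fintype.sum_equiv (Equiv.prodComm ι κ) _ _ fun y => ?_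
  simp [Matrix.conjTranspose_apply, mul_comm]

theorem norm_swapVec {ι κ : Type*} [Fintype ι] [Fintype κ] (α : EuclideanSpace ℂ (ι × κ)) :
    ‖(WithLp.toLp 2 fun x : κ × ι => star (α x.swap) : EuclideanSpace ℂ (κ × ι))‖ = ‖α‖ := by
  rw [← sq_eq_sq₀ (norm_nonneg _) (norm_nonneg _)]
  simp only [EuclideanSpace.norm_sq_eq]
  refine Fintype.sum_equiv (Equiv.prodComm κ ι) _ _ fun x => ?_
  simp

theorem projNorm_revStar_le (u : A ⊗[ℂ] A) : projNorm (revStar u) ≤ projNorm u := by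
  refine le_of_forall_gt_imp_ge_of_dense fun c hc => ?_
  obtain ⟨p, q, α, v, w, β, hu, hlt⟩ := exists_sandwich_lt hc
  rw [hu, revStar_sandwich]
  refine (projNorm_sandwich_le _ _ _ _).trans ?_
  rw [norm_swapVec, norm_swapVec, matNorm_conjTranspose, matNorm_conjTranspose]
  refine le_trans (le_of_eq ?_) hlt.le
  ring

theorem projNorm_revStar (u : A ⊗[ℂ] A) : projNorm (revStar u) = projNorm u := by
  have h := projNorm_revStar_le (revStar u)
  rw [revStar_revStar] at h
  exact le_antisymm (projNorm_revStar_le u) h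

end Reverse

section Completion

/-- The algebraic tensor product `A ⊗ B`, as a normed algebra under the operator space projective
tensor norm. -/
def AlgTensor (A B : Type*) [CStarAlgebra A] [CStarAlgebra B] : Type _ := A ⊗[ℂ] B

variable {A B : Type*} [CStarAlgebra A] [CStarAlgebra B]

instance : Ring (AlgTensor A B) := inferInstanceAs (Ring (A ⊗[ℂ] B))

instance : Algebra ℂ (AlgTensor A B) := inferInstanceAs (Algebra ℂ (A ⊗[ℂ] B))

instance : Norm (AlgTensor A B) := ⟨fun u => projNorm (A := A) (B := B) u⟩

theorem algTensor_core : SeminormedSpace.Core ℂ (AlgTensor A B) where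
  norm_nonneg u := projNorm_nonneg (A := A) (B := B) u
  norm_smul c u := projNorm_smul (A := A) (B := B) c u
  norm_triangle u v := projNorm_add_le (A := A) (B := B) u v

instance : SeminormedRing (AlgTensor A B) where
  __ := (inferInstance : Ring (AlgTensor A B))
  __ := SeminormedAddCommGroup.ofCore (algTensor_core (A := A) (B := B))
  norm_mul_le u v := projNorm_mul_le (A := A) (B := B) u v

instance : NormedAlgebra ℂ (AlgTensor A B) where
  norm_smul_le c u := (algTensor_core.norm_smul c u).le

/-- The operator space projective tensor product of two unital `C*`-algebras: the completion of
the algebraic tensor product, a Banach algebra with multiplication `(a ⊗ b)(c ⊗ d) = ac ⊗ bd`. -/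
abbrev ProjTensor (A B : Type*) [CStarAlgebra A] [CStarAlgebra B] : Type _ :=
  UniformSpace.Completion (AlgTensor A B)

/-- The Banach algebra `ProjTensor A A`, to be equipped with the reverse involution. -/
def RevProjTensor (A : Type*) [CStarAlgebra A] : Type _ := ProjTensor A A

instance : NormedRing (RevProjTensor A) := inferInstanceAs (NormedRing (ProjTensor A A))

instance : CompleteSpace (RevProjTensor A) := inferInstanceAs (CompleteSpace (ProjTensor A A))

instance : Algebra ℂ (RevProjTensor A) := inferInstanceAs (Algebra ℂ (ProjTensor A A))

instance : NormedAlgebra ℂ (RevProjTensor A) where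
  norm_smul_le c u := norm_smul_le (β := ProjTensor A A) c u

/-- The image in the completion of an element of the algebraic tensor product. -/
def ofAlg (u : A ⊗[ℂ] A) : RevProjTensor A :=
  UniformSpace.Completion.coe' (α := AlgTensor A A) u

/-- The reverse involution on `A ⊗ A` as a map of the normed space `AlgTensor A A`. -/
def algRevStar (u : AlgTensor A A) : AlgTensor A A := revStar (A := A) u

theorem isometry_algRevStar : Isometry (algRevStar (A := A)) := by
  refine Isometry.of_dist_eq fun u v => ?_
  rw [dist_eq_norm, dist_eq_norm]
  have h : algRevStar u - algRevStar v = algRevStar (u - v) := by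
    have h2 := revStar_add (A := A) (u - v : AlgTensor A A) v
    rw [sub_eq_iff_eq_add]
    refine Eq.trans ?_ h2
    exact congrArg algRevStar (sub_add_cancel u v).symm
  rw [h]
  exact projNorm_revStar (A := A) (u - v : AlgTensor A A)

/-- The reverse involution `(a ⊗ b)* = b* ⊗ a*`, extended by continuity to the completion. -/
instance : Star (RevProjTensor A) :=
  ⟨fun x => UniformSpace.Completion.map (algRevStar (A := A)) (x : ProjTensor A A)⟩

theorem star_ofAlg (u : A ⊗[ℂ] A) : star (ofAlg u) = ofAlg (revStar u) :=
  UniformSpace.Completion.map_coe isometry_algRevStar.uniformContinuous (u : AlgTensor A A)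

theorem star_ofAlg_tmul (a b : A) :
    star (ofAlg (a ⊗ₜ[ℂ] b)) = ofAlg (star b ⊗ₜ[ℂ] star a) := star_ofAlg _

theorem continuous_star_rev : Continuous (star : RevProjTensor A → RevProjTensor A) :=
  UniformSpace.Completion.continuous_map

theorem denseRange_ofAlg : DenseRange (ofAlg (A := A)) :=
  UniformSpace.Completion.denseRange_coe (α := AlgTensor A A)

theorem ofAlg_add (u v : A ⊗[ℂ] A) : ofAlg (u + v) = ofAlg u + ofAlg v :=
  UniformSpace.Completion.coe_add (α := AlgTensor A A) u v

theorem ofAlg_mul (u v : A ⊗[ℂ] A) : ofAlg (u * v) = ofAlg u * ofAlg v :=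
  UniformSpace.Completion.coe_mul (α := AlgTensor A A) u v

theorem ofAlg_smul (c : ℂ) (u : A ⊗[ℂ] A) : ofAlg (c • u) = c • ofAlg u :=
  UniformSpace.Completion.coe_smul (X := AlgTensor A A) c u

theorem norm_ofAlg (u : A ⊗[ℂ] A) : ‖ofAlg u‖ = projNorm u :=
  UniformSpace.Completion.norm_coe (E := AlgTensor A A) u

instance : StarRing (RevProjTensor A) where
  star_involutive x := by
    refine denseRange_ofAlg.induction_on x
      (isClosed_eq (continuous_star_rev.comp continuous_star_rev) continuous_id) fun u => ?_
    rw [star_ofAlg, star_ofAlg, revStar_revStar]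
  star_mul x y := by
    refine denseRange_ofAlg.induction_on₂ (p := fun x y => star (x * y) = star y * star x)
      (isClosed_eq ?_ ?_) (fun u v => ?_) x y
    · exact continuous_star_rev.comp (continuous_fst.mul continuous_snd)
    · exact (continuous_star_rev.comp continuous_snd).mul
        (continuous_star_rev.comp continuous_fst)
    · rw [← ofAlg_mul, star_ofAlg, star_ofAlg, star_ofAlg, revStar_mul, ofAlg_mul]
  star_add x y := by
    refine denseRange_ofAlg.induction_on₂ (p := fun x y => star (x + y) = star x + star y)
      (isClosed_eq ?_ ?_) (fun u v => ?_) x y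
    · exact continuous_star_rev.comp (continuous_fst.add continuous_snd)
    · exact (continuous_star_rev.comp continuous_fst).add
        (continuous_star_rev.comp continuous_snd)
    · rw [← ofAlg_add, star_ofAlg, star_ofAlg, star_ofAlg, revStar_add, ofAlg_add]

instance : StarModule ℂ (RevProjTensor A) where
  star_smul c x := by
    refine denseRange_ofAlg.induction_on x (isClosed_eq ?_ ?_) fun u => ?_
    · exact continuous_star_rev.comp (continuous_const_smul c)
    · exact continuous_star_rev.const_smul (star c)
    · rw [← ofAlg_smul, star_ofAlg, star_ofAlg, revStar_smul, ofAlg_smul]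

instance : NormedStarGroup (RevProjTensor A) where
  norm_star_le x := by
    refine denseRange_ofAlg.induction_on x
      (isClosed_le (continuous_norm.comp continuous_star_rev) continuous_norm) fun u => ?_
    rw [star_ofAlg, norm_ofAlg, norm_ofAlg, projNorm_revStar]

end Completion

/-- A `*`-algebra `X` over `ℂ` has a faithful `*`-representation: there is an injective
`*`-homomorphism from `X` to the bounded operators on some complex Hilbert space. -/
def HasFaithfulStarRep (X : Type u) [NonUnitalNonAssocSemiring X] [Module ℂ X] [Star X] :
    Prop :=
  ∃ (H : Type v) (_ : NormedAddCommGroup H) (_ : InnerProductSpace ℂ H) (_ : CompleteSpace H)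
    (π : X →⋆ₙₐ[ℂ] (H →L[ℂ] H)), Function.Injective π

end OpProj

end

/-!
If `b* a = 0`, then `u = a ⊗ b` satisfies `u* u = (b* ⊗ a*) (a ⊗ b) = b* a ⊗ a* b = 0` for the
reverse involution, so every `*`-representation `π` kills `u`, because `‖π u‖² = ‖π (u* u)‖`.
The element `u` survives in the completion: `‖a‖ ‖b‖ ≤ ‖a ⊗ b‖_∧`
(`norm_mul_norm_le_projNorm_tmul`). Hence a faithful `*`-representation forces `a = 0` or `b = 0`
whenever `b* a = 0` (`eq_zero_or_eq_zero_of_hasFaithfulStarRep`). A self-adjoint element with two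
points in its spectrum yields, by continuous functional calculus, nonzero self-adjoint `a`, `b`
with `b a = 0`; so every self-adjoint element of `A`, and then every element, is a scalar.

The lower bound for `‖a ⊗ b‖_∧` comes from norming functionals `f`, `g` of `a`, `b`: a bounded
functional on a `C*`-algebra is completely bounded with the same norm (`matNorm_map_le`), so
applying `f ⊗ g` to `α (v ⊗ w) β` gives at most `‖α‖ ‖v‖ ‖w‖ ‖β‖`.

Conversely, if `A = ℂ 1`, the completion consists of the multiples of its unit, so it is `ℂ` or
`0` and is represented by scalars on a Hilbert space of dimension one or zero.
-/

namespace OpProj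

section LowerBound

variable {A B : Type*} [CStarAlgebra A] [CStarAlgebra B] {n : Type*} [Fintype n]

/-- A scalar row and a scalar column compress a matrix `v` over `A` to the element `α v β` of `A`,
of norm at most `‖α‖ ‖v‖ ‖β‖`. -/
theorem norm_sum_smul_le_matNorm (α β : EuclideanSpace ℂ n) (v : Matrix n n A) :
    ‖∑ x, ∑ y, (α x * β y) • v x y‖ ≤ ‖α‖ * matNorm v * ‖β‖ := by
  let _ := CStarAlgebra.spectralOrder A
  have := CStarAlgebra.spectralOrderedRing A
  have hone : ‖(1 : A)‖ ≤ 1 := by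
    cases subsingleton_or_nontrivial A
    · simp [Subsingleton.elim (1 : A) 0]
    · exact CStarRing.norm_one.le
  have hvec (γ : n → ℂ) :
      ‖(WithCStarModule.equiv A (n → A)).symm fun i => γ i • (1 : A)‖
        ≤ √(∑ i, ‖γ i‖ ^ 2) := by
    rw [WithCStarModule.pi_norm]
    gcongr
    have h : ∑ i, γ i • (1 : A) * star (γ i • (1 : A))
        = ((∑ i, ‖γ i‖ ^ 2 : ℝ) : ℂ) • (1 : A) := by
      push_cast
      rw [Finset.sum_smul]
      refine Finset.sum_congr rfl fun i _ => ?_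
      rw [star_smul, star_one, smul_mul_smul_comm, one_mul, ← Complex.mul_conj']
      rfl
    have h' : ‖((∑ i, ‖γ i‖ ^ 2 : ℝ) : ℂ) • (1 : A)‖ ≤ ∑ i, ‖γ i‖ ^ 2 := by
      rw [norm_smul, Complex.norm_real, Real.norm_of_nonneg (by positivity)]
      exact mul_le_of_le_one_right (by positivity) hone
    exact (congrArg norm h).le.trans h'
  -- `α` and `β` become vectors of the Hilbert module `Aⁿ`; as matrices act on row vectors and the
  -- `A`-valued inner product is `⟪x, y⟫ = ∑ yᵢ xᵢ*`, `α v β` is the inner product `⟪β*, α v⟫`.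
  let a : WithCStarModule A (n → A) :=
    (WithCStarModule.equiv A (n → A)).symm fun i => α i • (1 : A)
  let b : WithCStarModule A (n → A) :=
    (WithCStarModule.equiv A (n → A)).symm fun i => star (β i) • (1 : A)
  have ha : ‖a‖ ≤ ‖α‖ := by
    rw [EuclideanSpace.norm_eq]
    exact hvec α
  have hb : ‖b‖ ≤ ‖β‖ := by
    rw [EuclideanSpace.norm_eq]
    simpa [b] using hvec fun i => star (β i)
  have hinner : ∑ x, ∑ y, (α x * β y) • v x y
      = inner A b (CStarMatrix.toCLM (CStarMatrix.ofMatrix v) a) := by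
    rw [CStarMatrix.toCLM_apply_eq_sum, Finset.sum_comm]
    refine Finset.sum_congr rfl fun j _ => ?_
    simp [WithCStarModule.inner_def, a, b, Finset.smul_sum, smul_smul, mul_comm,
      CStarMatrix.ofMatrix_apply]
  rw [hinner]
  calc _ ≤ ‖b‖ * ‖CStarMatrix.toCLM (CStarMatrix.ofMatrix v) a‖ :=
        CStarModule.norm_inner_le (WithCStarModule A (n → A))
    _ ≤ ‖b‖ * (matNorm v * ‖a‖) := by
      gcongr
      exact (CStarMatrix.toCLM (CStarMatrix.ofMatrix v)).le_opNorm a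
    _ ≤ ‖β‖ * (matNorm v * ‖α‖) := by
      have := matNorm_nonneg v
      gcongr
    _ = _ := by ring

/-- A bounded functional is completely bounded, with the same norm: for a scalar row `α` and
a scalar column `β`, `α f(v) β = f (α v β)`. -/
theorem matNorm_map_le (f : A →L[ℂ] ℂ) (v : Matrix n n A) :
    matNorm (v.map f) ≤ ‖f‖ * matNorm v := by
  let _ := CStarAlgebra.spectralOrder ℂ
  have := CStarAlgebra.spectralOrderedRing ℂ
  have hC : 0 ≤ ‖f‖ * matNorm v := mul_nonneg (norm_nonneg f) (matNorm_nonneg v)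
  -- The Hilbert module norm of `ℂⁿ` is the Euclidean norm.
  have hnorm (a : WithCStarModule ℂ (n → ℂ)) :
      ‖a‖ = ‖(WithLp.toLp 2 fun i => a i : EuclideanSpace ℂ n)‖ := by
    rw [WithCStarModule.pi_norm, EuclideanSpace.norm_eq]
    have h : ∑ i, a i * star (a i) = ((∑ i, ‖a i‖ ^ 2 : ℝ) : ℂ) := by
      push_cast
      exact Finset.sum_congr rfl fun i _ => Complex.mul_conj' (a i)
    have h' : ‖((∑ i, ‖a i‖ ^ 2 : ℝ) : ℂ)‖ = ∑ i, ‖a i‖ ^ 2 := by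
      rw [Complex.norm_real, Real.norm_of_nonneg (by positivity)]
    exact congrArg Real.sqrt ((congrArg norm h).trans h')
  refine CStarMatrix.norm_le_of_forall_inner_le (M := CStarMatrix.ofMatrix (v.map f))
    (C := ⟨_, hC⟩) fun a b => ?_
  have hinner : inner ℂ b (CStarMatrix.toCLM (CStarMatrix.ofMatrix (v.map f)) a)
      = f (∑ x, ∑ y, (a x * star (b y)) • v x y) := by
    rw [CStarMatrix.toCLM_apply_eq_sum, Finset.sum_comm, map_sum]
    refine Finset.sum_congr rfl fun j _ => ?_
    simp [Finset.sum_mul, mul_right_comm, CStarMatrix.ofMatrix_apply]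
  have hb : ‖(WithLp.toLp 2 fun i => star (b i) : EuclideanSpace ℂ n)‖ = ‖b‖ := by
    rw [hnorm]
    simp [EuclideanSpace.norm_eq]
  rw [hinner, hnorm a]
  refine (f.le_opNorm _).trans ?_
  have := norm_sum_smul_le_matNorm (WithLp.toLp 2 fun i => a i)
    (WithLp.toLp 2 fun i => star (b i)) v
  rw [hb] at this
  calc _ ≤ ‖f‖ * (_ * matNorm v * ‖b‖) := by gcongr
    _ = ‖f‖ * matNorm v * _ * ‖b‖ := by ring

/-- Half of the cross-norm property, which keeps `a ⊗ b` from vanishing in the completion. -/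
theorem norm_mul_norm_le_projNorm_tmul (a : A) (b : B) :
    ‖a‖ * ‖b‖ ≤ projNorm (a ⊗ₜ[ℂ] b) := by
  obtain ⟨f, hf, hfa⟩ := exists_dual_vector'' ℂ a
  obtain ⟨g, hg, hgb⟩ := exists_dual_vector'' ℂ b
  let F : A ⊗[ℂ] B →ₗ[ℂ] ℂ :=
    LinearMap.mul' ℂ ℂ ∘ₗ TensorProduct.map f.toLinearMap g.toLinearMap
  have hF : F (a ⊗ₜ[ℂ] b) = ((‖a‖ * ‖b‖ : ℝ) : ℂ) := by
    simp [F, hfa, hgb]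
  refine le_of_forall_gt_imp_ge_of_dense fun c hc => ?_
  obtain ⟨p, q, α, v, w, β, hu, hlt⟩ := exists_sandwich_lt hc
  have hFu : F (sandwich α v w β) = ∑ x, ∑ y, (α x * β y) •
      (Matrix.of fun x y : Fin p × Fin q => v.map f x.1 y.1 * w.map g x.2 y.2) x y := by
    simp [sandwich, F]
  have hv := matNorm_nonneg v
  have hw := matNorm_nonneg w
  have hfv : matNorm (v.map f) ≤ matNorm v :=
    (matNorm_map_le f v).trans (mul_le_of_le_one_left hv hf)
  have hgw : matNorm (w.map g) ≤ matNorm w :=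
    (matNorm_map_le g w).trans (mul_le_of_le_one_left hw hg)
  calc ‖a‖ * ‖b‖ = ‖F (sandwich α v w β)‖ := by
        rw [← hu, hF, Complex.norm_real, Real.norm_of_nonneg (by positivity)]
    _ ≤ ‖α‖ * matNorm _ * ‖β‖ := hFu ▸ norm_sum_smul_le_matNorm α β _
    _ ≤ ‖α‖ * (matNorm v * matNorm w) * ‖β‖ := by
        gcongr
        refine (matNorm_kronecker_le _ _).trans ?_
        have := matNorm_nonneg (w.map g)
        gcongr
    _ = ‖α‖ * matNorm v * matNorm w * ‖β‖ := by ring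
    _ ≤ c := hlt.le

end LowerBound

section ZeroDivisors

variable {A : Type u} [CStarAlgebra A]

theorem eq_zero_or_eq_zero_of_hasFaithfulStarRep
    (h : HasFaithfulStarRep.{u, v} (RevProjTensor A)) {a b : A} (hab : star b * a = 0) :
    a = 0 ∨ b = 0 := by
  obtain ⟨H, _, _, _, π, hπ⟩ := h
  have hz : star (ofAlg (a ⊗ₜ[ℂ] b)) * ofAlg (a ⊗ₜ[ℂ] b) = 0 := by
    rw [star_ofAlg_tmul, ← ofAlg_mul, Algebra.TensorProduct.tmul_mul_tmul, hab,
      TensorProduct.zero_tmul]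
    simpa using ofAlg_smul (0 : ℂ) (0 : A ⊗[ℂ] A)
  have hπ0 : π (ofAlg (a ⊗ₜ[ℂ] b)) = 0 := by
    rw [← CStarRing.star_mul_self_eq_zero_iff, ← map_star, ← map_mul, hz, map_zero]
  have h0 : ofAlg (a ⊗ₜ[ℂ] b) = 0 := hπ (hπ0.trans (map_zero π).symm)
  have hle := norm_mul_norm_le_projNorm_tmul a b
  rw [← norm_ofAlg, h0, norm_zero] at hle
  have : ‖a‖ * ‖b‖ = 0 := le_antisymm hle (by positivity)
  simpa using this

/-- If two points `s < t` were in the spectrum of `x`, the functions `(m - ·)⁺` and `(· - m)⁺`,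
where `m` is the midpoint, would give nonzero elements with product zero. -/
theorem exists_eq_smul_one_of_isSelfAdjoint
    (h : ∀ a b : A, star b * a = 0 → a = 0 ∨ b = 0) {x : A} (hx : IsSelfAdjoint x) :
    ∃ r : ℝ, x = r • (1 : A) := by
  cases subsingleton_or_nontrivial A
  · exact ⟨0, Subsingleton.elim _ _⟩
  have hss : (spectrum ℝ x).Subsingleton := by
    intro s hs t ht
    by_contra hne
    wlog hst : s < t generalizing s t
    · exact this ht hs (Ne.symm hne) (lt_of_le_of_ne (not_lt.1 hst) (Ne.symm hne))
    let m := (s + t) / 2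
    let f : ℝ → ℝ := fun r => max (m - r) 0
    let g : ℝ → ℝ := fun r => max (r - m) 0
    have hf : Continuous f := by fun_prop
    have hg : Continuous g := by fun_prop
    have hfg : star (cfc g x) * cfc f x = 0 := by
      rw [(cfc_predicate g x : IsSelfAdjoint (cfc g x)).star_eq,
        ← cfc_mul g f x hg.continuousOn hf.continuousOn]
      have : (fun r => g r * f r) = fun _ => 0 := by
        funext r
        rcases le_total r m with hr | hr
        · simp [g, hr]
        · simp [f, hr]
      rw [this]
      exact cfc_zero ℝ x
    have key (k : ℝ → ℝ) (hk : Continuous k) (r : ℝ) (hr : r ∈ spectrum ℝ x)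
        (h0 : cfc k x = 0) : k r = 0 := by
      have hmem : k r ∈ spectrum ℝ (cfc k x) := by
        rw [cfc_map_spectrum k x hx hk.continuousOn]
        exact ⟨r, hr, rfl⟩
      simpa [h0, spectrum.zero_eq] using hmem
    rcases h _ _ hfg with h0 | h0
    · have := key f hf s hs h0
      have h2 : m - s ≤ 0 := this ▸ le_max_left _ _
      simp only [m] at h2
      linarith
    · have := key g hg t ht h0
      have h2 : t - m ≤ 0 := this ▸ le_max_left _ _
      simp only [m] at h2
      linarith
  obtain ⟨r, hr⟩ := ContinuousFunctionalCalculus.spectrum_nonempty (R := ℝ) x hx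
  refine ⟨r, ?_⟩
  rw [← Algebra.algebraMap_eq_smul_one, ← cfc_const r x hx]
  conv_lhs => rw [← cfc_id ℝ x hx]
  exact cfc_congr fun t ht => hss ht hr

end ZeroDivisors

section Scalar

variable {A : Type u} [CStarAlgebra A]

/-- If every element is a scalar, the algebra is `0` or `ℂ`. -/
theorem hasFaithfulStarRep_of_surjective_algebraMap (X : Type u) [Ring X] [Algebra ℂ X]
    [StarRing X] [StarModule ℂ X] (hX : Function.Surjective (algebraMap ℂ X)) :
    HasFaithfulStarRep.{u, v} X := by
  cases subsingleton_or_nontrivial X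
  · exact ⟨PUnit, inferInstance, inferInstance, inferInstance, 0,
      Function.injective_of_subsingleton _⟩
  · let e : ℂ ≃⋆ₐ[ℂ] X := StarAlgEquiv.ofBijective (StarAlgHom.ofId ℂ X)
      ⟨(algebraMap ℂ X).injective, hX⟩
    let H := EuclideanSpace ℂ PUnit.{v + 1}
    let ρ : ℂ →⋆ₐ[ℂ] (H →L[ℂ] H) := StarAlgHom.ofId ℂ _
    refine ⟨H, inferInstance, inferInstance, inferInstance,
      (ρ : ℂ →⋆ₙₐ[ℂ] (H →L[ℂ] H)).comp (e.symm : X →⋆ₙₐ[ℂ] ℂ), ?_⟩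
    exact (algebraMap ℂ (H →L[ℂ] H)).injective.comp e.symm.injective

theorem surjective_algebraMap_revProjTensor (h : ∀ a : A, ∃ c : ℂ, a = c • (1 : A)) :
    Function.Surjective (algebraMap ℂ (RevProjTensor A)) := by
  have hcl : IsClosed ((Submodule.span ℂ {(1 : RevProjTensor A)} : Submodule ℂ _) :
      Set (RevProjTensor A)) := Submodule.closed_of_finiteDimensional _
  intro x
  suffices x ∈ Submodule.span ℂ {(1 : RevProjTensor A)} by
    obtain ⟨c, hc⟩ := Submodule.mem_span_singleton.1 this
    exact ⟨c, by rw [Algebra.algebraMap_eq_smul_one, hc]⟩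
  refine denseRange_ofAlg.induction_on x hcl fun w => ?_
  induction w using TensorProduct.induction_on with
  | zero =>
    have : ofAlg (0 : A ⊗[ℂ] A) = 0 := by simpa using ofAlg_smul (0 : ℂ) (0 : A ⊗[ℂ] A)
    rw [this]
    exact zero_mem _
  | tmul a b =>
    obtain ⟨c, rfl⟩ := h a
    obtain ⟨d, rfl⟩ := h b
    rw [TensorProduct.smul_tmul_smul, ofAlg_smul]
    exact Submodule.smul_mem _ _ (Submodule.mem_span_singleton_self _)
  | add u w hu hw =>
    rw [ofAlg_add]
    exact add_mem hu hw

end Scalar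

end OpProj

theorem mainTheorem10 (A : Type u) [CStarAlgebra A] :
    OpProj.HasFaithfulStarRep.{u, v} (OpProj.RevProjTensor A) ↔
      ∀ a : A, ∃ c : ℂ, a = c • (1 : A) := by
  refine ⟨fun h a => ?_, fun h => OpProj.hasFaithfulStarRep_of_surjective_algebraMap _
    (OpProj.surjective_algebraMap_revProjTensor h)⟩
  have key {x : A} (hx : IsSelfAdjoint x) : ∃ r : ℝ, x = r • (1 : A) :=
    OpProj.exists_eq_smul_one_of_isSelfAdjoint
      (fun _ _ hab => OpProj.eq_zero_or_eq_zero_of_hasFaithfulStarRep h hab) hx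
  obtain ⟨r, hr⟩ := key (realPart a).2
  obtain ⟨s, hs⟩ := key (imaginaryPart a).2
  refine ⟨r + Complex.I * s, ?_⟩
  rw [← realPart_add_I_smul_imaginaryPart a, hr, hs, add_smul, mul_smul, Complex.coe_smul,
    Complex.coe_smul]
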